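/- Setting. Consider a unitary rational conformal model with a finite set $P$ of primaries, vacuum $0\in P$, fusion rule coefficients $N_{pq}^{r}\in\mathbb{Z}_{\ge 0}$, and a modular matrix $S\in\mathbb{C}^{P\times P}$ that is symmetric and unitary, has positive vacuum row ($S_{0p}>0$ for all $p$), and satisfies Verlinde's formula $N_{pq}^{r}=\sum_{s}S_{ps}S_{qs}\overline{S_{rs}}/S_{0s}$. Write $d_p=S_{0p}/S_{00}$ for the quantum dimension of $p$, and $\rho_p(\alpha)=S_{\alpha p}/S_{0p}$ for the irreducible representation of the fusion algebra corresponding to $p$. The deconstruction lattice $\mathscr{L}$ consists of the sets $\mathfrak{g}\subseteq P$ with $0\in\mathfrak{g}$ such that $p,q\in\mathfrak{g}$ and $N_{pq}^{r}>0$ imply $r\in\mathfrak{g}$. For $\mathfrak{g}\in\mathscr{L}$, the $\mathfrak{g}$-classes are the blocks of the partition of $P$ in which $p,q$ lie in the same block if and only if $\rho_p(\alpha)=\rho_q(\alpha)$ for all $\alpha\in\mathfrak{g}$. The trivial class $\mathfrak{g}^{\perp}\in\mathscr{L}$ is the $\mathfrak{g}$-class containing $0$. A $\mathfrak{g}$-class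 $\mathtt{C}$ is central if its mass $\sum_{p\in\mathtt{C}}d_p^{2}$ is minimal among all $\mathfrak{g}$-classes. The central $\mathfrak{g}$-classes form an abelian group $\mathtt{Z}(\mathfrak{g})$, the center of $\mathfrak{g}$, whose identity is $\mathfrak{g}^{\perp}$ and whose product is given by fusion: $\mathtt{z}_1\mathtt{z}_2=\{r : N_{pq}^{r}>0 \text{ for some } p\in\mathtt{z}_1,\ q\in\mathtt{z}_2\}$. The central character of $\mathtt{z}\in\mathtt{Z}(\mathfrak{g})$ is $\varpi_{\mathtt{z}}(\alpha)=\rho_p(\alpha)/d_\alpha$ for $\alpha\in\mathfrak{g}$, with any $p\in\mathtt{z}$. The maximal central quotient of $\mathfrak{g}$ is $\boldsymbol{\partial}\mathfrak{g}=\{\alpha\in\mathfrak{g} : \varpi_{\mathtt{z}}(\alpha)=1 \text{ for all } \mathtt{z}\in\mathtt{Z}(\mathfrak{g})\}\in\mathscr{L}$. Theorem. Let $\mathfrak{g},\mathfrak{h}\in\mathscr{L}$ with $\mathfrak{h}\subseteq\mathfrak{g}$. For every central $\mathfrak{g}$-class $\mathtt{z}$ there is a unique $\mathfrak{h}$-class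 containing $\mathtt{z}$; this $\mathfrak{h}$-class is central, and the map that assigns it to $\mathtt{z}$ is a group homomorphism $\mathtt{Z}(\mathfrak{g})\to\mathtt{Z}(\mathfrak{h})$ (the restriction homomorphism). Its image is $\{\mathtt{z}\in\mathtt{Z}(\mathfrak{h}) : \mathtt{z}\cap(\boldsymbol{\partial}\mathfrak{g})^{\perp}\neq\emptyset\}$, and its kernel is $\{\mathtt{z}\in\mathtt{Z}(\mathfrak{g}) : \mathtt{z}\subseteq\mathfrak{h}^{\perp}\}$. -/

import Mathlib

/-- The data of a (unitary) rational conformal model with finite set of primaries `P` that enter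
its deconstruction lattice: the vacuum, the fusion rule coefficients `N p q r` (the multiplicity of
`r` in the fusion product of `p` and `q`) and the modular `S`-matrix. The matrix `S` is symmetric
and unitary, its vacuum row is positive, and fusion rules and `S` are related by Verlinde's
formula. -/
structure ConformalModel (P : Type*) [Fintype P] [DecidableEq P] where
  vac : P
  N : P → P → P → ℕ
  S : Matrix P P ℂ
  symm : S.transpose = S
  unitary : S ∈ Matrix.unitaryGroup P ℂ
  vac_im : ∀ p, (S vac p).im = 0
  vac_pos : ∀ p, 0 < (S vac p).re
  verlinde : ∀ p q r, (N p q r : ℂ) = ∑ s, S p s * S q s * star (S r s) / S vac s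

namespace ConformalModel

variable {P : Type*} [Fintype P] [DecidableEq P] (M : ConformalModel P)

/-- The quantum dimension of a primary. -/
noncomputable def qdim (p : P) : ℝ := (M.S M.vac p).re / (M.S M.vac M.vac).re

/-- The value at the primary `α` of the irreducible representation of the fusion algebra that
corresponds to the primary `p`. -/
noncomputable def rep (p α : P) : ℂ := M.S α p / M.S M.vac p

/-- The ratio of `rep p α` and the dimension of `α`. -/
noncomputable def mono (p α : P) : ℂ := M.rep p α / M.qdim α

/-- The elements of the deconstruction lattice: sets of primaries that contain the vacuum and are
closed under the fusion product. -/
structure FCSet where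
  carrier : Set P
  vac_mem : M.vac ∈ carrier
  closed : ∀ {p q r : P}, p ∈ carrier → q ∈ carrier → 0 < M.N p q r → r ∈ carrier

instance : SetLike M.FCSet P where
  coe := FCSet.carrier
  coe_injective := by
    rintro ⟨a, _, _⟩ ⟨b, _, _⟩ h
    simpa using h

/-- The `g`-class of the primary `p`. -/
def classOf (g : M.FCSet) (p : P) : Set P := {q | ∀ α ∈ g, M.rep q α = M.rep p α}

/-- `C` is one of the blocks of the partition of the primaries into `g`-classes. -/
def IsClass (g : M.FCSet) (C : Set P) : Prop := ∃ p, C = M.classOf g p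

open Classical in
/-- The mass of a set of primaries. -/
noncomputable def mass (C : Set P) : ℝ := ∑ p with p ∈ C, M.qdim p ^ 2

/-- The central `g`-classes: those of minimal mass. -/
def IsCentral (g : M.FCSet) (C : Set P) : Prop :=
  M.IsClass g C ∧ ∀ D, M.IsClass g D → M.mass C ≤ M.mass D

/-! Elementary facts about the `S`-matrix. -/

theorem S_symm (p q : P) : M.S p q = M.S q p := by
  conv_lhs => rw [← M.symm]
  rfl

theorem S_vac (p : P) : M.S M.vac p = ((M.S M.vac p).re : ℂ) := by
  apply Complex.ext <;> simp [M.vac_im p]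

theorem S_vac_ne (p : P) : M.S M.vac p ≠ 0 := by
  intro h
  have := M.vac_pos p
  rw [h] at this
  simp at this

theorem orth_col (s t : P) : ∑ r, star (M.S r s) * M.S r t = if s = t then 1 else 0 := by
  have h := (Matrix.mem_unitaryGroup_iff').1 M.unitary
  have h2 := congrFun (congrFun h s) t
  simpa [Matrix.mul_apply, Matrix.one_apply, Matrix.star_apply] using h2

theorem orth_row (s t : P) : ∑ r, M.S s r * star (M.S t r) = if s = t then 1 else 0 := by
  have h := (Matrix.mem_unitaryGroup_iff).1 M.unitary
  have h2 := congrFun (congrFun h s) t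
  simpa [Matrix.mul_apply, Matrix.one_apply, Matrix.star_apply] using h2

theorem qdim_pos (p : P) : 0 < M.qdim p := div_pos (M.vac_pos _) (M.vac_pos _)

theorem qdim_ne (p : P) : (M.qdim p : ℂ) ≠ 0 := by exact_mod_cast (M.qdim_pos p).ne'

theorem qdim_vac : M.qdim M.vac = 1 := div_self (M.vac_pos _).ne'

theorem qdim_eq (p : P) : (M.qdim p : ℂ) = M.S M.vac p / M.S M.vac M.vac := by
  rw [M.S_vac p, M.S_vac M.vac, qdim]
  push_cast
  simp

theorem rep_vac (p : P) : M.rep p M.vac = 1 := div_self (M.S_vac_ne p)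

theorem rep_eq (p α : P) : M.rep p α = M.qdim α * M.mono p α := by
  rw [mono, mul_div_cancel₀ _ (M.qdim_ne α)]

theorem rep_vac_left (α : P) : M.rep M.vac α = M.qdim α := by
  rw [rep, qdim_eq, M.S_symm]

theorem mono_vac (α : P) : M.mono M.vac α = 1 := by
  rw [mono, rep_vac_left, div_self (M.qdim_ne α)]

theorem mono_eq (p α : P) :
    M.mono p α = M.S p α * M.S M.vac M.vac / (M.S M.vac p * M.S M.vac α) := by
  have h1 := M.S_vac_ne p
  have h2 := M.S_vac_ne α
  have h3 := M.S_vac_ne M.vac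
  rw [mono, rep, qdim_eq, M.S_symm p α]
  field_simp

theorem mono_symm (p α : P) : M.mono p α = M.mono α p := by
  rw [mono_eq, mono_eq, M.S_symm p α, mul_comm (M.S M.vac p)]

theorem sum_N_S (p q α : P) :
    ∑ r, (M.N p q r : ℂ) * M.S r α = M.S p α * M.S q α / M.S M.vac α := by
  simp_rw [M.verlinde, Finset.sum_mul]
  rw [Finset.sum_comm]
  have : ∀ s, ∑ r, M.S p s * M.S q s * star (M.S r s) / M.S M.vac s * M.S r α
      = M.S p s * M.S q s / M.S M.vac s * (if s = α then 1 else 0) := by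
    intro s
    rw [← M.orth_col s α, Finset.mul_sum]
    exact Finset.sum_congr rfl fun r _ => by ring
  rw [Finset.sum_congr rfl fun s _ => this s]
  simp

/-- `rep s` is a representation of the fusion algebra. -/
theorem rep_mul (s p q : P) : M.rep s p * M.rep s q = ∑ r, (M.N p q r : ℂ) * M.rep s r := by
  simp only [rep, ← mul_div_assoc]
  rw [← Finset.sum_div, sum_N_S]
  ring

theorem sum_N_mono (p q α : P) :
    ∑ r, (M.N p q r : ℂ) * (M.qdim r * M.mono r α)
      = M.qdim p * M.qdim q * (M.mono p α * M.mono q α) := by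
  simp_rw [fun r => M.mono_symm r α, ← rep_eq]
  rw [← rep_mul, rep_eq, rep_eq]
  ring

theorem sum_N_qdim (p q : P) : ∑ r, (M.N p q r : ℝ) * M.qdim r = M.qdim p * M.qdim q := by
  have h := M.sum_N_mono p q M.vac
  simp_rw [fun r => M.mono_symm r M.vac, mono_vac] at h
  simp only [mul_one] at h
  exact_mod_cast h

theorem exists_N_pos (p q : P) : ∃ r, 0 < M.N p q r := by
  by_contra! h
  have h2 := M.sum_N_qdim p q
  have h3 : ∀ r, M.N p q r = 0 := fun r => by have := h r; omega
  simp only [h3, Nat.cast_zero, zero_mul, Finset.sum_const_zero] at h2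
  exact absurd h2 (mul_pos (M.qdim_pos p) (M.qdim_pos q)).ne

theorem norm_rep_le (p α : P) : ‖M.rep p α‖ ≤ M.qdim α := by
  have : Nonempty P := ⟨p⟩
  obtain ⟨x, hx⟩ := Finite.exists_max (fun x => ‖M.S x p‖ / M.qdim x)
  have hle : ∀ y, ‖M.S y p‖ ≤ ‖M.S x p‖ / M.qdim x * M.qdim y := fun y =>
    (div_le_iff₀ (M.qdim_pos y)).1 (hx y)
  have hxpos : 0 < ‖M.S x p‖ := by
    rcases (norm_nonneg (M.S x p)).lt_or_eq with h | h
    · exact h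
    · exfalso
      have := hle M.vac
      rw [← h, zero_div, zero_mul] at this
      exact M.S_vac_ne p (norm_le_zero_iff.1 this)
  have h1 : M.rep p α * M.S x p = ∑ r, (M.N α x r : ℂ) * M.S r p := by
    rw [sum_N_S, rep]; ring
  have h2 : ‖M.rep p α‖ * ‖M.S x p‖ ≤ M.qdim α * ‖M.S x p‖ := by
    rw [← norm_mul, h1]
    calc ‖∑ r, (M.N α x r : ℂ) * M.S r p‖ ≤ ∑ r, ‖(M.N α x r : ℂ) * M.S r p‖ := norm_sum_le _ _
      _ ≤ ∑ r, ‖M.S x p‖ / M.qdim x * ((M.N α x r : ℝ) * M.qdim r) := by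
          refine Finset.sum_le_sum fun r _ => ?_
          rw [norm_mul, Complex.norm_natCast]
          calc (M.N α x r : ℝ) * ‖M.S r p‖
              ≤ (M.N α x r : ℝ) * (‖M.S x p‖ / M.qdim x * M.qdim r) :=
                mul_le_mul_of_nonneg_left (hle r) (Nat.cast_nonneg _)
            _ = _ := by ring
      _ = M.qdim α * ‖M.S x p‖ := by
          rw [← Finset.mul_sum, sum_N_qdim]
          have := (M.qdim_pos x).ne'
          field_simp
  exact le_of_mul_le_mul_right h2 hxpos

theorem norm_mono_le (p α : P) : ‖M.mono p α‖ ≤ 1 := by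
  rw [mono, norm_div, Complex.norm_real, Real.norm_of_nonneg (M.qdim_pos α).le]
  exact (div_le_one (M.qdim_pos α)).2 (M.norm_rep_le p α)

theorem norm_mono_eq_one (p α : P) : ‖M.mono p α‖ = 1 ↔ ‖M.rep p α‖ = M.qdim α := by
  rw [mono, norm_div, Complex.norm_real, Real.norm_of_nonneg (M.qdim_pos α).le,
    div_eq_one_iff_eq (M.qdim_pos α).ne']

theorem eq_one_of_re {x : ℂ} (h : ‖x‖ ≤ 1) (hr : 1 ≤ x.re) : x = 1 := by
  have h2 : x.re * x.re + x.im * x.im ≤ 1 := by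
    rw [← Complex.normSq_apply, Complex.normSq_eq_norm_sq]
    nlinarith [norm_nonneg x]
  have h3 : x.im = 0 := by nlinarith [mul_self_nonneg x.im]
  have h4 : x.re = 1 := by nlinarith [mul_self_nonneg x.im]
  exact Complex.ext (by simpa using h4) (by simpa using h3)

theorem mono_mul {p q r α : P} (h : 0 < M.N p q r) (hp : ‖M.mono p α‖ = 1)
    (hq : ‖M.mono q α‖ = 1) : M.mono r α = M.mono p α * M.mono q α := by
  set u := M.mono p α * M.mono q α with hu
  have hu1 : ‖u‖ = 1 := by rw [hu, norm_mul, hp, hq, one_mul]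
  have huu : star u * u = 1 := by
    rw [Complex.star_def, Complex.conj_mul', hu1]; norm_num
  have key : ∑ t, (M.N p q t : ℝ) * M.qdim t * (1 - (star u * M.mono t α).re) = 0 := by
    have e1 := M.sum_N_mono p q α
    rw [← hu] at e1
    have e2 : ∑ t, ((M.N p q t : ℝ) * M.qdim t : ℝ) * (star u * M.mono t α)
        = (M.qdim p * M.qdim q : ℝ) := by
      calc _ = star u * ∑ t, (M.N p q t : ℂ) * (M.qdim t * M.mono t α) := by
            rw [Finset.mul_sum]
            refine Finset.sum_congr rfl fun t _ => ?_
            push_cast; ring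
        _ = _ := by
            rw [e1]
            push_cast
            linear_combination (M.qdim p * M.qdim q : ℂ) * huu
    have e3 := congrArg Complex.re e2
    rw [Complex.re_sum] at e3
    simp only [Complex.re_ofReal_mul, Complex.ofReal_re] at e3
    simp only [mul_sub, mul_one, Finset.sum_sub_distrib]
    rw [e3, sum_N_qdim, sub_self]
  have hnorm : ∀ t, ‖star u * M.mono t α‖ ≤ 1 := fun t => by
    rw [norm_mul, norm_star, hu1, one_mul]; exact M.norm_mono_le t α
  have hz := (Finset.sum_eq_zero_iff_of_nonneg (fun t _ => mul_nonneg
    (mul_nonneg (Nat.cast_nonneg _) (M.qdim_pos t).le)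
    (sub_nonneg.2 ((Complex.re_le_norm _).trans (hnorm t))))).1 key r (Finset.mem_univ r)
  have hw : (M.N p q r : ℝ) * M.qdim r ≠ 0 :=
    (mul_pos (by exact_mod_cast h) (M.qdim_pos r)).ne'
  have h1 : 1 - (star u * M.mono r α).re = 0 := (mul_eq_zero.1 hz).resolve_left hw
  have h2 := eq_one_of_re (hnorm r) (by linarith)
  have h3 : u * (star u * M.mono r α) = u := by rw [h2, mul_one]
  linear_combination h3 - M.mono r α * huu

/-- The trivial `g`-class, i.e. the `g`-class of the vacuum, as an element of the deconstruction
lattice. -/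
def dual (g : M.FCSet) : M.FCSet where
  carrier := M.classOf g M.vac
  vac_mem := fun _ _ => rfl
  closed := by
    intro p q r hp hq h α hα
    have e : ∀ x, M.rep x α = M.rep M.vac α ↔ M.mono x α = 1 := fun x => by
      rw [rep_vac_left, mono, div_eq_one_iff_eq (M.qdim_ne α)]
    have hp' := (e p).1 (hp α hα)
    have hq' := (e q).1 (hq α hα)
    rw [e, M.mono_mul h (by rw [hp', norm_one]) (by rw [hq', norm_one]), hp', hq', one_mul]

/-! Charge conjugation. -/

theorem exists_conj (p : P) : ∃ q, ∀ s, M.S q s = star (M.S p s) := by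
  have hstar : ∀ s, star (M.S M.vac s) = M.S M.vac s := fun s => by
    rw [M.S_vac s, Complex.star_def, Complex.conj_ofReal]
  have hC : ∀ q, (M.N p q M.vac : ℂ) = ∑ s, M.S p s * M.S q s := fun q => by
    rw [M.verlinde]
    refine Finset.sum_congr rfl fun s _ => ?_
    rw [hstar, mul_div_cancel_right₀ _ (M.S_vac_ne s)]
  have h1 : ∀ s, ∑ q, (M.N p q M.vac : ℂ) * star (M.S q s) = M.S p s := fun s => by
    simp_rw [hC, Finset.sum_mul]
    rw [Finset.sum_comm]
    have : ∀ t, ∑ q, M.S p t * M.S q t * star (M.S q s)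
        = M.S p t * (if s = t then 1 else 0) := fun t => by
      rw [← M.orth_col s t, Finset.mul_sum]
      exact Finset.sum_congr rfl fun q _ => by ring
    rw [Finset.sum_congr rfl fun t _ => this t]
    simp
  have h2 : ∑ q, (M.N p q M.vac : ℂ) * (M.N p q M.vac : ℂ) = 1 := by
    have h3 : ∀ q, (M.N p q M.vac : ℂ) = ∑ s, star (M.S p s) * star (M.S q s) := fun q => by
      have := congrArg star (hC q)
      simpa using this
    calc _ = ∑ q, (M.N p q M.vac : ℂ) * ∑ s, star (M.S p s) * star (M.S q s) :=
          Finset.sum_congr rfl fun q _ => by rw [← h3]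
      _ = ∑ s, star (M.S p s) * ∑ q, (M.N p q M.vac : ℂ) * star (M.S q s) := by
          simp_rw [Finset.mul_sum]
          rw [Finset.sum_comm]
          exact Finset.sum_congr rfl fun s _ => Finset.sum_congr rfl fun q _ => by ring
      _ = ∑ s, M.S p s * star (M.S p s) :=
          Finset.sum_congr rfl fun s _ => by rw [h1, mul_comm]
      _ = 1 := by rw [orth_row]; simp
  have h4 : ∑ q, M.N p q M.vac * M.N p q M.vac = 1 := by exact_mod_cast h2
  obtain ⟨q, hq⟩ : ∃ q, M.N p q M.vac ≠ 0 := by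
    by_contra! h
    simp [h] at h4
  have h5 := Finset.add_sum_erase Finset.univ (fun q => M.N p q M.vac * M.N p q M.vac)
    (Finset.mem_univ q)
  simp only [h4] at h5
  have hq1 : 1 ≤ M.N p q M.vac := Nat.one_le_iff_ne_zero.2 hq
  have hq2 : M.N p q M.vac = 1 :=
    le_antisymm (by have := Nat.mul_le_mul_left (M.N p q M.vac) hq1; omega) hq1
  have h6 : ∑ x ∈ Finset.univ.erase q, M.N p x M.vac * M.N p x M.vac = 0 := by
    rw [hq2] at h5; omega
  have h7 : ∀ x, x ≠ q → M.N p x M.vac = 0 := fun x hx => by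
    have := (Finset.sum_eq_zero_iff.1 h6) x (by simp [hx])
    simpa using this
  refine ⟨q, fun s => ?_⟩
  rw [← h1 s, Finset.sum_eq_single q]
  · simp [hq2]
  · intro x _ hx
    simp [h7 x hx]
  · simp

/-- The charge conjugate of a primary. -/
noncomputable def conj (p : P) : P := (M.exists_conj p).choose

theorem S_conj (p s : P) : M.S (M.conj p) s = star (M.S p s) := (M.exists_conj p).choose_spec s

theorem star_S_vac (s : P) : star (M.S M.vac s) = M.S M.vac s := by
  rw [M.S_vac s, Complex.star_def, Complex.conj_ofReal]

theorem N_conj (p q r : P) : M.N (M.conj p) r q = M.N p q r := by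
  have h : (M.N (M.conj p) r q : ℂ) = star (M.N p q r : ℂ) := by
    rw [M.verlinde, M.verlinde, star_sum]
    refine Finset.sum_congr rfl fun s _ => ?_
    rw [S_conj, star_div₀, star_mul', star_mul', star_star, star_S_vac]
    ring
  simpa using h

theorem mono_conj (p α : P) : M.mono (M.conj p) α = star (M.mono p α) := by
  rw [mono_eq, mono_eq, S_conj, star_div₀, star_mul', star_mul', star_S_vac, star_S_vac, star_S_vac,
    M.S_symm M.vac (M.conj p), S_conj, ← M.S_symm M.vac p, star_S_vac]

theorem qdim_conj (p : P) : M.qdim (M.conj p) = M.qdim p := by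
  rw [qdim, qdim, M.S_symm M.vac (M.conj p), S_conj, ← M.S_symm M.vac p, star_S_vac]

theorem rep_conj_right (p α : P) : M.rep p (M.conj α) = star (M.rep p α) := by
  rw [rep, rep, S_conj, star_div₀, star_S_vac]

theorem eq_conj_of_N_pos {p q : P} (h : 0 < M.N p q M.vac) : q = M.conj p := by
  by_contra hne
  have h1 : (M.N p q M.vac : ℂ) = 0 := by
    rw [M.verlinde]
    calc _ = ∑ s, M.S q s * star (M.S (M.conj p) s) := by
          refine Finset.sum_congr rfl fun s _ => ?_
          rw [star_S_vac, mul_div_cancel_right₀ _ (M.S_vac_ne s), S_conj, star_star, mul_comm]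
      _ = 0 := by rw [orth_row, if_neg hne]
  exact h.ne' (by exact_mod_cast h1)

open Classical in
theorem conj_mem (g : M.FCSet) {α : P} (hα : α ∈ g) : M.conj α ∈ g := by
  have hs : ∀ β ∈ g, ∑ γ with γ ∈ g, (M.N α β γ : ℝ) * M.qdim γ = M.qdim α * M.qdim β := by
    intro β hβ
    rw [← M.sum_N_qdim, Finset.sum_filter]
    refine Finset.sum_congr rfl fun γ _ => ?_
    split_ifs with h
    · rfl
    · have : M.N α β γ = 0 := by
        by_contra h0
        exact h (g.closed hα hβ (Nat.pos_of_ne_zero h0))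
      simp [this]
  have hfull : ∀ γ, ∑ β, (M.N α β γ : ℝ) * M.qdim β = M.qdim α * M.qdim γ := by
    intro γ
    simp_rw [← M.N_conj α]
    rw [sum_N_qdim, qdim_conj]
  have hle : ∀ γ, ∑ β with β ∈ g, (M.N α β γ : ℝ) * M.qdim β ≤ M.qdim α * M.qdim γ := by
    intro γ
    rw [← hfull]
    exact Finset.sum_le_univ_sum_of_nonneg fun β =>
      mul_nonneg (Nat.cast_nonneg _) (M.qdim_pos β).le
  have hz : ∑ γ with γ ∈ g, M.qdim γ *
      (M.qdim α * M.qdim γ - ∑ β with β ∈ g, (M.N α β γ : ℝ) * M.qdim β) = 0 := by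
    simp_rw [mul_sub, Finset.sum_sub_distrib, Finset.mul_sum]
    rw [Finset.sum_comm (s := Finset.univ.filter (· ∈ g)), sub_eq_zero]
    refine Finset.sum_congr rfl fun β hβ => ?_
    have hβ' : β ∈ g := (Finset.mem_filter.1 hβ).2
    rw [← hs β hβ', Finset.mul_sum]
    exact Finset.sum_congr rfl fun γ _ => by ring
  have h0 := (Finset.sum_eq_zero_iff_of_nonneg (fun γ _ => mul_nonneg (M.qdim_pos γ).le
    (sub_nonneg.2 (hle γ)))).1 hz M.vac (Finset.mem_filter.2 ⟨Finset.mem_univ _, g.vac_mem⟩)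
  rw [qdim_vac, one_mul, mul_one, sub_eq_zero] at h0
  obtain ⟨β, hβ, hne⟩ : ∃ β ∈ g, M.N α β M.vac ≠ 0 := by
    by_contra! h
    have : ∑ β with β ∈ g, (M.N α β M.vac : ℝ) * M.qdim β = 0 :=
      Finset.sum_eq_zero fun β hβ => by simp [h β (Finset.mem_filter.1 hβ).2]
    rw [this] at h0
    exact (M.qdim_pos α).ne' h0
  rw [← M.eq_conj_of_N_pos (Nat.pos_of_ne_zero hne)]
  exact hβ

/-! The mass of a class, and the characterization of central classes. -/

open Classical in
theorem class_orth (g : M.FCSet) (p q : P) (h : q ∉ M.classOf g p) :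
    ∑ α with α ∈ g, M.rep q α * star (M.rep p α) = 0 := by
  obtain ⟨β, hβ, hne⟩ : ∃ β ∈ g, M.rep q β ≠ M.rep p β := by
    simpa [classOf] using h
  have ext : ∀ (x α β : P), α ∈ g → β ∈ g →
      ∑ γ with γ ∈ g, (M.N β α γ : ℂ) * M.rep x γ = M.rep x β * M.rep x α := by
    intro x α β hα hβ
    rw [rep_mul, Finset.sum_filter]
    refine Finset.sum_congr rfl fun γ _ => ?_
    split_ifs with hγ
    · rfl
    · have : M.N β α γ = 0 := by
        by_contra h0
        exact hγ (g.closed hβ hα (Nat.pos_of_ne_zero h0))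
      simp [this]
  have e : M.rep q β * ∑ α with α ∈ g, M.rep q α * star (M.rep p α)
      = M.rep p β * ∑ α with α ∈ g, M.rep q α * star (M.rep p α) := by
    calc _ = ∑ α with α ∈ g, ∑ γ with γ ∈ g,
          (M.N β α γ : ℂ) * M.rep q γ * star (M.rep p α) := by
          rw [Finset.mul_sum]
          refine Finset.sum_congr rfl fun α hα => ?_
          rw [← mul_assoc, ← ext q α β (Finset.mem_filter.1 hα).2 hβ, Finset.sum_mul]
      _ = ∑ γ with γ ∈ g, M.rep q γ * star
          (∑ α with α ∈ g, (M.N (M.conj β) γ α : ℂ) * M.rep p α) := by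
          rw [Finset.sum_comm]
          refine Finset.sum_congr rfl fun γ _ => ?_
          rw [star_sum, Finset.mul_sum]
          refine Finset.sum_congr rfl fun α _ => ?_
          rw [N_conj, star_mul', star_natCast]
          ring
      _ = _ := by
          rw [Finset.mul_sum]
          refine Finset.sum_congr rfl fun γ hγ => ?_
          rw [ext p γ (M.conj β) (Finset.mem_filter.1 hγ).2 (M.conj_mem g hβ), star_mul',
            rep_conj_right, star_star]
          ring
  have e2 : (M.rep q β - M.rep p β) * ∑ α with α ∈ g, M.rep q α * star (M.rep p α) = 0 := by
    rw [sub_mul, e, sub_self]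
  exact (mul_eq_zero.1 e2).resolve_left (sub_ne_zero.2 hne)

open Classical in
theorem mass_classOf (g : M.FCSet) (p : P) :
    (M.S M.vac M.vac).re ^ 2 * M.mass (M.classOf g p) * ∑ α with α ∈ g, ‖M.rep p α‖ ^ 2 = 1 := by
  have h1 : ∑ q, (M.S M.vac q) ^ 2 * ∑ α with α ∈ g, M.rep q α * star (M.rep p α) = 1 := by
    simp_rw [Finset.mul_sum]
    rw [Finset.sum_comm]
    have : ∀ α, ∑ q, M.S M.vac q ^ 2 * (M.rep q α * star (M.rep p α))
        = star (M.rep p α) * (if α = M.vac then 1 else 0) := by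
      intro α
      rw [← M.orth_row α M.vac, Finset.mul_sum]
      refine Finset.sum_congr rfl fun q _ => ?_
      rw [star_S_vac, rep]
      have := M.S_vac_ne q
      field_simp
    simp_rw [this]
    rw [Finset.sum_eq_single M.vac]
    · simp [rep_vac]
    · intro b _ hb
      simp [hb]
    · intro hb
      exact absurd (Finset.mem_filter.2 ⟨Finset.mem_univ _, g.vac_mem⟩) hb
  have h2 : ∀ q, (M.S M.vac q) ^ 2 * ∑ α with α ∈ g, M.rep q α * star (M.rep p α)
      = if q ∈ M.classOf g p then
        (((M.S M.vac M.vac).re ^ 2 * M.qdim q ^ 2 * ∑ α with α ∈ g, ‖M.rep p α‖ ^ 2 : ℝ) : ℂ)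
        else 0 := by
    intro q
    split_ifs with hq
    · have : ∑ α with α ∈ g, M.rep q α * star (M.rep p α)
          = ((∑ α with α ∈ g, ‖M.rep p α‖ ^ 2 : ℝ) : ℂ) := by
        push_cast
        refine Finset.sum_congr rfl fun α hα => ?_
        rw [hq α (Finset.mem_filter.1 hα).2, Complex.star_def, Complex.mul_conj']
      rw [this, Complex.ofReal_mul]
      congr 1
      push_cast
      rw [qdim_eq, ← S_vac]
      have := M.S_vac_ne M.vac
      field_simp
    · rw [M.class_orth g p q hq, mul_zero]
  simp_rw [h2] at h1
  rw [← Finset.sum_filter, ← Complex.ofReal_sum] at h1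
  rw [← Finset.sum_mul, ← Finset.mul_sum] at h1
  rw [mass]
  exact_mod_cast h1

theorem mem_classOf_self (g : M.FCSet) (p : P) : p ∈ M.classOf g p := fun _ _ => rfl

theorem classOf_eq {g : M.FCSet} {p q : P} (h : q ∈ M.classOf g p) :
    M.classOf g p = M.classOf g q := by
  ext x
  exact ⟨fun hx α hα => (hx α hα).trans (h α hα).symm, fun hx α hα => (hx α hα).trans (h α hα)⟩

theorem mem_classOf_iff (g : M.FCSet) (p q : P) :
    q ∈ M.classOf g p ↔ ∀ α ∈ g, M.mono q α = M.mono p α := by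
  refine forall₂_congr fun α _ => ?_
  rw [mono, mono, div_left_inj' (M.qdim_ne α)]

theorem isCentral_classOf_iff (g : M.FCSet) (p : P) :
    M.IsCentral g (M.classOf g p) ↔ ∀ α ∈ g, ‖M.mono p α‖ = 1 := by
  classical
  have hs : 0 < (M.S M.vac M.vac).re ^ 2 := pow_pos (M.vac_pos _) 2
  have hterm : ∀ x α, ‖M.rep x α‖ ^ 2 ≤ M.qdim α ^ 2 := fun x α =>
    pow_le_pow_left₀ (norm_nonneg _) (M.norm_rep_le x α) 2
  have hF : ∀ x, 0 < ∑ α with α ∈ g, ‖M.rep x α‖ ^ 2 := by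
    intro x
    refine Finset.sum_pos' (fun _ _ => by positivity) ⟨M.vac, ?_, ?_⟩
    · exact Finset.mem_filter.2 ⟨Finset.mem_univ _, g.vac_mem⟩
    · simp [rep_vac]
  have hvac : ∑ α with α ∈ g, ‖M.rep M.vac α‖ ^ 2 = ∑ α with α ∈ g, M.qdim α ^ 2 := by
    refine Finset.sum_congr rfl fun α _ => ?_
    rw [rep_vac_left, Complex.norm_real, Real.norm_of_nonneg (M.qdim_pos α).le]
  have hm : ∀ x y, M.mass (M.classOf g x) ≤ M.mass (M.classOf g y) ↔
      ∑ α with α ∈ g, ‖M.rep y α‖ ^ 2 ≤ ∑ α with α ∈ g, ‖M.rep x α‖ ^ 2 := by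
    intro x y
    have e : ∀ z, M.mass (M.classOf g z)
        = ((M.S M.vac M.vac).re ^ 2)⁻¹ * (∑ α with α ∈ g, ‖M.rep z α‖ ^ 2)⁻¹ := by
      intro z
      have h1 := M.mass_classOf g z
      rw [← mul_inv]
      refine eq_inv_of_mul_eq_one_left ?_
      linear_combination h1
    rw [e, e, mul_le_mul_iff_right₀ (inv_pos.2 hs), inv_le_inv₀ (hF x) (hF y)]
  constructor
  · rintro ⟨-, h⟩ α hα
    have h1 := (hm p M.vac).1 (h _ ⟨M.vac, rfl⟩)
    rw [hvac] at h1
    have h2 : ∑ α with α ∈ g, ‖M.rep p α‖ ^ 2 = ∑ α with α ∈ g, M.qdim α ^ 2 :=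
      le_antisymm (Finset.sum_le_sum fun α _ => hterm p α) h1
    have h3 := (Finset.sum_eq_sum_iff_of_le (fun α _ => hterm p α)).1 h2 α
      (Finset.mem_filter.2 ⟨Finset.mem_univ _, hα⟩)
    rw [norm_mono_eq_one]
    exact (pow_left_inj₀ (norm_nonneg _) (M.qdim_pos α).le two_ne_zero).1 h3
  · intro h
    refine ⟨⟨p, rfl⟩, ?_⟩
    rintro _ ⟨q, rfl⟩
    rw [hm]
    refine Finset.sum_le_sum fun α hα => ?_
    rw [(M.norm_mono_eq_one p α).1 (h α (Finset.mem_filter.1 hα).2)]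
    exact hterm q α

/-! The center. -/

/-- The set of central `g`-classes. -/
def Center (g : M.FCSet) : Type _ := {C : Set P // M.IsCentral g C}

/-- A central class, viewed as a set of primaries. -/
def Center.toSet {M : ConformalModel P} {g : M.FCSet} (z : M.Center g) : Set P := z.1

variable {M} {g : M.FCSet}

theorem Center.nonempty (z : M.Center g) : ∃ p, p ∈ z.toSet := by
  obtain ⟨⟨p, hp⟩, -⟩ := z.2
  exact ⟨p, by rw [toSet, hp]; exact M.mem_classOf_self g p⟩

theorem Center.eq_classOf (z : M.Center g) {p : P} (hp : p ∈ z.toSet) :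
    z.toSet = M.classOf g p := by
  obtain ⟨⟨q, hq⟩, -⟩ := z.2
  rw [toSet, hq] at hp ⊢
  exact M.classOf_eq hp

theorem Center.norm_mono (z : M.Center g) {p : P} (hp : p ∈ z.toSet) :
    ∀ α ∈ g, ‖M.mono p α‖ = 1 := by
  rw [← M.isCentral_classOf_iff g p, ← z.eq_classOf hp]
  exact z.2

/-- The central character of a central class (only its values on `g` are meaningful): the common
value of `rep p α / qdim α` for the elements `p` of the class. -/
noncomputable def centralChar (z : M.Center g) (α : P) : ℂ :=
  M.rep z.nonempty.choose α / M.qdim α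

theorem centralChar_eq (z : M.Center g) {p : P} (hp : p ∈ z.toSet) :
    ∀ α ∈ g, centralChar z α = M.mono p α := by
  have h := z.nonempty.choose_spec
  exact (M.mem_classOf_iff g p _).1 ((z.eq_classOf hp).subset h)

theorem mem_toSet_iff (z : M.Center g) (p : P) :
    p ∈ z.toSet ↔ ∀ α ∈ g, M.mono p α = centralChar z α := by
  rw [z.eq_classOf z.nonempty.choose_spec, mem_classOf_iff]
  rfl

theorem Center.ext_char {z w : M.Center g} (h : ∀ α ∈ g, centralChar z α = centralChar w α) :
    z = w := by
  apply Subtype.ext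
  ext p
  change p ∈ z.toSet ↔ p ∈ w.toSet
  rw [mem_toSet_iff, mem_toSet_iff]
  exact forall₂_congr fun α hα => by rw [h α hα]

theorem norm_centralChar (z : M.Center g) {α : P} (hα : α ∈ g) : ‖centralChar z α‖ = 1 :=
  z.norm_mono z.nonempty.choose_spec α hα

variable (M) in
/-- The set of primaries that appear in a fusion product of elements of `A` and `B`. -/
def fuse (A B : Set P) : Set P := {r | ∃ p ∈ A, ∃ q ∈ B, 0 < M.N p q r}

theorem mem_fuse_iff (z w : M.Center g) (r : P) :
    r ∈ M.fuse z.toSet w.toSet ↔ ∀ α ∈ g, M.mono r α = centralChar z α * centralChar w α := by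
  constructor
  · rintro ⟨p, hp, q, hq, h⟩ α hα
    rw [centralChar_eq z hp α hα, centralChar_eq w hq α hα]
    exact M.mono_mul h (z.norm_mono hp α hα) (w.norm_mono hq α hα)
  · intro h
    obtain ⟨p, hp⟩ := z.nonempty
    obtain ⟨q, hq⟩ := M.exists_N_pos (M.conj p) r
    refine ⟨p, hp, q, ?_, by rwa [M.N_conj] at hq⟩
    rw [mem_toSet_iff]
    intro α hα
    have hz := norm_centralChar z hα
    have hzz : star (centralChar z α) * centralChar z α = 1 := by
      rw [Complex.star_def, Complex.conj_mul', hz]; norm_num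
    have hc : M.mono (M.conj p) α = star (centralChar z α) := by
      rw [mono_conj, centralChar_eq z hp α hα]
    rw [M.mono_mul hq (by rw [hc, norm_star, hz])
      (by rw [h α hα, norm_mul, hz, norm_centralChar w hα, one_mul]), hc, h α hα, ← mul_assoc,
      hzz, one_mul]

theorem isCentral_fuse (z w : M.Center g) : M.IsCentral g (M.fuse z.toSet w.toSet) := by
  obtain ⟨p, hp⟩ := z.nonempty
  obtain ⟨q, hq⟩ := w.nonempty
  obtain ⟨r, hr⟩ := M.exists_N_pos p q
  have hr' := (mem_fuse_iff z w r).1 ⟨p, hp, q, hq, hr⟩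
  have : M.fuse z.toSet w.toSet = M.classOf g r := by
    ext x
    rw [mem_fuse_iff, mem_classOf_iff]
    exact forall₂_congr fun α hα => by rw [hr' α hα]
  rw [this, isCentral_classOf_iff]
  intro α hα
  rw [hr' α hα, norm_mul, norm_centralChar z hα, norm_centralChar w hα, one_mul]

/-- The product of central classes, given by fusion. -/
instance : Mul (M.Center g) := ⟨fun z w => ⟨M.fuse z.toSet w.toSet, isCentral_fuse z w⟩⟩

/-- The identity is the trivial class. -/
instance : One (M.Center g) := ⟨⟨M.dual g, (M.isCentral_classOf_iff g M.vac).2 fun α _ => by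
  rw [mono_vac, norm_one]⟩⟩

theorem isCentral_conj (z : M.Center g) : M.IsCentral g {p | M.conj p ∈ z.toSet} := by
  obtain ⟨p, hp⟩ := z.nonempty
  have : {p | M.conj p ∈ z.toSet} = M.classOf g (M.conj p) := by
    ext x
    rw [Set.mem_ofPred_eq, mem_toSet_iff, mem_classOf_iff]
    refine forall₂_congr fun α hα => ?_
    rw [mono_conj, mono_conj, centralChar_eq z hp α hα, star_eq_iff_star_eq, eq_comm]
  rw [this, isCentral_classOf_iff]
  intro α hα
  rw [mono_conj, norm_star, z.norm_mono hp α hα]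

/-- The inverse of a central class consists of the charge conjugates of its elements. -/
noncomputable instance : Inv (M.Center g) :=
  ⟨fun z => ⟨{p | M.conj p ∈ z.toSet}, isCentral_conj z⟩⟩

theorem centralChar_mul (z w : M.Center g) {α : P} (hα : α ∈ g) :
    centralChar (z * w) α = centralChar z α * centralChar w α :=
  (mem_fuse_iff z w _).1 (z * w).nonempty.choose_spec α hα

theorem centralChar_one {α : P} (hα : α ∈ g) : centralChar (1 : M.Center g) α = 1 := by
  rw [centralChar_eq (1 : M.Center g) (p := M.vac) (M.dual g).vac_mem α hα, mono_vac]

theorem centralChar_inv (z : M.Center g) {α : P} (hα : α ∈ g) :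
    centralChar z⁻¹ α = star (centralChar z α) := by
  have h : M.conj (z⁻¹).nonempty.choose ∈ z.toSet := (z⁻¹).nonempty.choose_spec
  rw [centralChar_eq z h α hα, mono_conj, star_star]
  rfl

/-- The center of `g` is an abelian group. -/
noncomputable instance : CommGroup (M.Center g) where
  mul_assoc a b c := Center.ext_char fun α hα => by simp only [centralChar_mul _ _ hα, mul_assoc]
  one_mul a := Center.ext_char fun α hα => by
    rw [centralChar_mul _ _ hα, centralChar_one hα, one_mul]
  mul_one a := Center.ext_char fun α hα => by
    rw [centralChar_mul _ _ hα, centralChar_one hα, mul_one]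
  inv_mul_cancel a := Center.ext_char fun α hα => by
    rw [centralChar_mul _ _ hα, centralChar_inv _ hα, centralChar_one hα, Complex.star_def,
      Complex.conj_mul', norm_centralChar a hα]
    norm_num
  mul_comm a b := Center.ext_char fun α hα => by simp only [centralChar_mul _ _ hα, mul_comm]

variable (g) in
/-- The central quotient of `g` by a subgroup `H` of its center: the elements of `g` on which all
central characters of the classes in `H` are trivial. -/
def centralQuotient (H : Subgroup (M.Center g)) : M.FCSet where
  carrier := {α | α ∈ g ∧ ∀ z ∈ H, centralChar z α = 1}
  vac_mem := ⟨g.vac_mem, fun z _ => by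
    rw [centralChar_eq z z.nonempty.choose_spec _ g.vac_mem, mono_symm, mono_vac]⟩
  closed := by
    rintro α β γ ⟨hα, hα'⟩ ⟨hβ, hβ'⟩ h
    have hγ : γ ∈ g := g.closed hα hβ h
    refine ⟨hγ, fun z hz => ?_⟩
    have h1 := hα' z hz
    have h2 := hβ' z hz
    have hp := z.nonempty.choose_spec
    rw [centralChar_eq z hp _ hα, mono_symm] at h1
    rw [centralChar_eq z hp _ hβ, mono_symm] at h2
    rw [centralChar_eq z hp _ hγ, mono_symm,
      M.mono_mul h (by rw [h1, norm_one]) (by rw [h2, norm_one]), h1, h2, one_mul]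

variable (g) in
/-- The maximal central quotient of `g`. -/
noncomputable def maxCentralQuotient : M.FCSet := centralQuotient g ⊤

end ConformalModel

namespace ConformalModel

variable {P : Type*} [Fintype P] [DecidableEq P] (M : ConformalModel P)

/-! By `isCentral_classOf_iff`, the `g`-class of `p` is central exactly when `|mono p α| = 1` for
all `α ∈ g`. This condition only weakens when `g` shrinks to `h`, so each member of a central
`g`-class has a central `h`-class, and that `h`-class is the same for all members. On characters
this is restriction from `g` to `h`. Since central characters determine central classes and multiply
under fusion, the resulting map is a homomorphism.

A central `h`-class lies in the image iff it meets the union `U` of the central `g`-classes: if `p`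
lies in both, the `g`-class of `p` is a preimage. The description of the image thus reduces to `U =
(∂g)^⊥`, which is `mem_dual_maxCentralQuotient`. It rests on the duality `g^⊥⊥ = g` (`dual_dual`),
obtained by comparing masses. The kernel follows from uniqueness of the containing `h`-class,
applied to `h^⊥`. -/

/-! ### Duality on the deconstruction lattice -/

theorem mem_dual_iff (g : M.FCSet) (p : P) : p ∈ M.dual g ↔ ∀ α ∈ g, M.mono p α = 1 := by
  change p ∈ M.classOf g M.vac ↔ _
  rw [mem_classOf_iff]
  simp only [mono_vac]

theorem dual_anti {g h : M.FCSet} (hgh : ∀ α ∈ h, α ∈ g) : ∀ p ∈ M.dual g, p ∈ M.dual h := by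
  intro p hp
  rw [mem_dual_iff] at hp ⊢
  exact fun α hα => hp α (hgh α hα)

/-- Symmetry of `mono` lets the two arguments exchange roles; this is the easy half of the duality.
-/
theorem mem_dual_dual (g : M.FCSet) {p : P} (hp : p ∈ g) : p ∈ M.dual (M.dual g) := by
  rw [mem_dual_iff]
  intro α hα
  rw [mono_symm]
  exact (M.mem_dual_iff g α).1 hα p hp

/-- The case of the vacuum in `mass_classOf`: there `rep` equals the quantum dimension, so the sum
of squared norms becomes the mass of `g`. -/
theorem mass_dual_mul_mass (g : M.FCSet) :
    (M.S M.vac M.vac).re ^ 2 * M.mass (M.dual g : Set P) * M.mass (g : Set P) = 1 := by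
  rw [← M.mass_classOf g M.vac, mass.eq_1 M (g : Set P)]
  congr 1
  refine Finset.sum_congr rfl fun α _ => ?_
  rw [rep_vac_left, Complex.norm_real, Real.norm_of_nonneg (M.qdim_pos α).le]

/-- Every primary has strictly positive weight `d_p²`, so a proper inclusion strictly increases the
mass. -/
theorem eq_of_subset_of_mass_eq {A B : Set P} (hAB : A ⊆ B) (h : M.mass A = M.mass B) :
    A = B := by
  classical
  refine hAB.antisymm fun p hp => ?_
  by_contra hpA
  refine h.not_lt (Finset.sum_lt_sum_of_subset (i := p) ?_ ?_ ?_ ?_ ?_)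
  · exact fun x hx => by simpa using hAB (by simpa using hx)
  · simpa using hp
  · simpa using hpA
  · exact pow_pos (M.qdim_pos p) 2
  · exact fun _ _ _ => sq_nonneg _

/-- One inclusion is `mem_dual_dual`. The masses agree, because each is the reciprocal of `S₀₀²`
times the mass of `g^⊥`. -/
theorem dual_dual (g : M.FCSet) : M.dual (M.dual g) = g := by
  refine SetLike.coe_injective (M.eq_of_subset_of_mass_eq (fun p hp => M.mem_dual_dual g hp) ?_).symm
  have h1 := M.mass_dual_mul_mass g
  have h2 := M.mass_dual_mul_mass (M.dual g)
  have h3 : (M.S M.vac M.vac).re ^ 2 * M.mass (M.dual g : Set P) ≠ 0 := left_ne_zero_of_mul_eq_one h1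
  refine mul_left_cancel₀ h3 ?_
  rw [h1, ← h2]
  ring

/-! ### The union of the central classes and the maximal central quotient -/

/-- The union of the central `g`-classes. -/
def centralUnion (g : M.FCSet) : M.FCSet where
  carrier := {p | ∀ α ∈ g, ‖M.mono p α‖ = 1}
  vac_mem := fun α _ => by rw [mono_vac, norm_one]
  closed := by
    intro p q r hp hq h α hα
    -- Values of modulus one multiply under fusion, so unit modulus persists.
    rw [M.mono_mul h (hp α hα) (hq α hα), norm_mul, hp α hα, hq α hα, one_mul]

variable {M} {g : M.FCSet}

theorem Center.mem_centralUnion (z : M.Center g) {p : P} (hp : p ∈ z.toSet) :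
    p ∈ M.centralUnion g :=
  z.norm_mono hp

/-- The trivial class of the maximal central quotient is the union of the central classes. -/
theorem mem_dual_maxCentralQuotient (p : P) :
    p ∈ M.dual (maxCentralQuotient g) ↔ p ∈ M.centralUnion g := by
  constructor
  -- With `U = U^⊥⊥`, antitonicity reduces this direction to `U^⊥ ⊆ ∂g`.
  · rw [← M.dual_dual (M.centralUnion g)]
    refine M.dual_anti (fun α hα => ?_) p
    -- The trivial class is one of the central classes, so `g^⊥ ⊆ U` and hence `U^⊥ ⊆ g^⊥⊥ = g`.
    have hg : α ∈ g := by
      rw [← M.dual_dual g]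
      refine M.dual_anti (g := M.centralUnion g) (fun q hq => ?_) α hα
      intro β hβ
      rw [(M.mem_dual_iff g q).1 hq β hβ, norm_one]
    refine ⟨hg, fun z _ => ?_⟩
    obtain ⟨q, hq⟩ := z.nonempty
    rw [centralChar_eq z hq α hg, mono_symm]
    exact (M.mem_dual_iff _ α).1 hα q (z.mem_centralUnion hq)
  · intro hp
    rw [mem_dual_iff]
    rintro α ⟨hα, hα'⟩
    -- The `g`-class of `p` is central, and its character takes the value 1 on `∂g` by definition of
    -- `∂g`.
    let z : M.Center g := ⟨M.classOf g p, (M.isCentral_classOf_iff g p).2 hp⟩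
    rw [← centralChar_eq z (M.mem_classOf_self g p) α hα]
    exact hα' z trivial

/-! ### The restriction homomorphism -/

/-- The `h`-class that contains a given central `g`-class, where `h` is contained in `g`. -/
noncomputable def restrictClass {h : M.FCSet} (hgh : (h : Set P) ⊆ (g : Set P))
    (z : M.Center g) : M.Center h :=
  ⟨M.classOf h z.nonempty.choose, (M.isCentral_classOf_iff h _).2 fun α hα =>
    z.norm_mono z.nonempty.choose_spec α (hgh hα)⟩

theorem centralChar_restrictClass {h : M.FCSet} (hgh : (h : Set P) ⊆ (g : Set P))
    (z : M.Center g) {α : P} (hα : α ∈ h) :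
    centralChar (restrictClass hgh z) α = centralChar z α :=
  -- The representative chosen for `restrictClass` is the one defining `centralChar z`, so the two
  -- values agree by definition.
  centralChar_eq _ (M.mem_classOf_self h _) α hα

/-- The restriction homomorphism. -/
noncomputable def restrictHom {h : M.FCSet} (hgh : (h : Set P) ⊆ (g : Set P)) :
    M.Center g →* M.Center h where
  toFun := restrictClass hgh
  -- Both laws are checked on characters over `h`, where restriction leaves the values unchanged.
  map_one' := Center.ext_char fun α hα => by
    rw [centralChar_restrictClass hgh _ hα, centralChar_one (hgh hα), centralChar_one hα]
  map_mul' z w := Center.ext_char fun α hα => by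
    rw [centralChar_mul _ _ hα, centralChar_restrictClass hgh _ hα,
      centralChar_restrictClass hgh _ hα, centralChar_restrictClass hgh _ hα,
      centralChar_mul _ _ (hgh hα)]

theorem subset_restrictHom {h : M.FCSet} (hgh : (h : Set P) ⊆ (g : Set P)) (z : M.Center g) :
    z.toSet ⊆ (restrictHom hgh z).toSet := by
  intro p hp
  rw [mem_toSet_iff]
  intro α hα
  rw [← centralChar_eq z hp α (hgh hα)]
  exact (centralChar_restrictClass hgh z hα).symm

/-- Existence and uniqueness of the containing class in one equivalence: `z` is nonempty, and
`h`-classes sharing a point coincide. -/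
theorem subset_iff_eq_restrictHom {h : M.FCSet} (hgh : (h : Set P) ⊆ (g : Set P))
    (z : M.Center g) {C : Set P} (hC : M.IsClass h C) :
    z.toSet ⊆ C ↔ C = (restrictHom hgh z).toSet := by
  constructor
  · intro hzC
    obtain ⟨p, hp⟩ := z.nonempty
    obtain ⟨q, rfl⟩ := hC
    rw [Center.eq_classOf _ (subset_restrictHom hgh z hp), M.classOf_eq (hzC hp)]
  · rintro rfl
    exact subset_restrictHom hgh z

end ConformalModel

open ConformalModel in
theorem mainTheorem5 {P : Type*} [Fintype P] [DecidableEq P] (M : ConformalModel P)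
    (g h : M.FCSet) (hgh : (h : Set P) ⊆ (g : Set P)) :
    ∃ res : M.Center g →* M.Center h,
      (∀ z : M.Center g, ∀ C : Set P, M.IsClass h C → (z.toSet ⊆ C ↔ C = (res z).toSet)) ∧
      (res.range : Set (M.Center h)) =
        {z | (z.toSet ∩ (M.dual (ConformalModel.maxCentralQuotient g) : Set P)).Nonempty} ∧
      (res.ker : Set (M.Center g)) = {z | z.toSet ⊆ (M.dual h : Set P)} := by
  refine ⟨restrictHom hgh, fun z C hC => subset_iff_eq_restrictHom hgh z hC, ?_, ?_⟩
  · ext w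
    constructor
    · rintro ⟨z, rfl⟩
      obtain ⟨p, hp⟩ := z.nonempty
      exact ⟨p, subset_restrictHom hgh z hp,
        (mem_dual_maxCentralQuotient p).2 (z.mem_centralUnion hp)⟩
    · rintro ⟨p, hpw, hp⟩
      -- The preimage of `w` is the `g`-class of the common point `p`, central because `(∂g)^⊥` is
      -- the union of the central classes.
      let z : M.Center g := ⟨M.classOf g p,
        (M.isCentral_classOf_iff g p).2 ((mem_dual_maxCentralQuotient p).1 hp)⟩
      have hpz : p ∈ z.toSet := M.mem_classOf_self g p
      refine ⟨z, Subtype.ext ?_⟩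
      -- The image of `z` and `w` are both the `h`-class of `p`.
      exact ((restrictHom hgh z).eq_classOf (subset_restrictHom hgh z hpz)).trans
        (w.eq_classOf hpw).symm
  · ext z
    -- The set `h^⊥` is the `h`-class of the vacuum and underlies the identity of the center of `h`,
    -- so containment in it says that `z` restricts to 1.
    have h1 := subset_iff_eq_restrictHom hgh z (C := (M.dual h : Set P)) ⟨M.vac, rfl⟩
    refine Iff.trans ?_ h1.symm
    exact ⟨fun hz => congrArg Center.toSet (Eq.symm hz), fun hz => Subtype.ext hz.symm⟩
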